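/- For a subgroup $G \subseteq \mathrm{O}(n)$, a $G$-manifold is an $n$-dimensional smooth Riemannian manifold $X$ such that, for every $x \in X$, the holonomy group at $x$ of the Levi-Civita connection is contained in $G$ when $T_xX$ is identified with $\mathbb{R}^n$ by a suitable orthonormal basis. Identify $\mathbb{R}^{2m}$ with $\mathbb{C}^m$, so that $\mathrm{SU}(m) \subseteq \mathrm{O}(2m)$. A Calabi--Yau manifold of real dimension $2m$ is an $\mathrm{SU}(m)$-manifold. Let $$\mathcal{G} = \mathrm{S}(\mathrm{U}(3)\times \mathrm{U}(2)) = \left\{ x \in \mathrm{SU}(5) : x = \begin{pmatrix} g & 0 \\ 0 & h\end{pmatrix},\ g \in \mathrm{U}(3),\ h \in \mathrm{U}(2)\right\} \subseteq \mathrm{SU}(5) \subseteq \mathrm{O}(10).$$ If $M$ and $K$ are Calabi--Yau manifolds of real dimensions $4$ and $6$, respectively, then $M \times K$ with the product Riemannian metric is a $\mathcal{G}$-manifold. -/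

import Mathlib

open Bundle Set Manifold Matrix
open scoped ContDiff

noncomputable section

namespace HolonomyReduction

/-! ### Subgroups of the orthogonal groups -/

/-- The real `2m × 2m` matrix of the real-linear map `z ↦ A z` of `ℂ^m`, where `ℂ^m` is identified
with `ℝ^(2m)` by `x + i y ↦ (x, y)`: the block matrix with rows `(Re A, -Im A)`, `(Im A, Re A)`. -/
def realMatrix {m : ℕ} (A : Matrix (Fin m) (Fin m) ℂ) :
    Matrix (Fin (2 * m)) (Fin (2 * m)) ℝ :=
  Matrix.reindex (finSumFinEquiv.trans (finCongr (two_mul m).symm))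
    (finSumFinEquiv.trans (finCongr (two_mul m).symm))
    (Matrix.fromBlocks (A.map Complex.re) (-(A.map Complex.im))
      (A.map Complex.im) (A.map Complex.re))

theorem realMatrix_one (m : ℕ) : realMatrix (1 : Matrix (Fin m) (Fin m) ℂ) = 1 := by
  have h1 : (1 : Matrix (Fin m) (Fin m) ℂ).map Complex.re = 1 := by
    ext i j
    by_cases h : i = j <;> simp [Matrix.one_apply, h]
  have h2 : (1 : Matrix (Fin m) (Fin m) ℂ).map Complex.im = 0 := by
    ext i j
    by_cases h : i = j <;> simp [h]
  unfold realMatrix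
  rw [h1, h2, neg_zero, Matrix.fromBlocks_one, Matrix.reindex_apply]
  exact Matrix.submatrix_one_equiv _

theorem realMatrix_mul {m : ℕ} (A B : Matrix (Fin m) (Fin m) ℂ) :
    realMatrix (A * B) = realMatrix A * realMatrix B := by
  have h1 : (A * B).map Complex.re = A.map Complex.re * B.map Complex.re +
      -(A.map Complex.im) * B.map Complex.im := by
    ext i j
    simp [Matrix.mul_apply, sub_eq_add_neg, Finset.sum_add_distrib]
  have h2 : (A * B).map Complex.im = A.map Complex.im * B.map Complex.re +
      A.map Complex.re * B.map Complex.im := by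
    ext i j
    simp [Matrix.mul_apply, Finset.sum_add_distrib, add_comm]
  unfold realMatrix
  simp only [Matrix.reindex_apply]
  rw [Matrix.submatrix_mul_equiv, Matrix.fromBlocks_multiply, h1, h2]
  congr 2 <;> simp [add_comm]

theorem realMatrix_star {m : ℕ} (A : Matrix (Fin m) (Fin m) ℂ) :
    realMatrix (star A) = star (realMatrix A) := by
  unfold realMatrix
  simp only [Matrix.reindex_apply, Matrix.star_eq_conjTranspose,
    Matrix.conjTranspose_submatrix, Matrix.fromBlocks_conjTranspose]
  congr 2
  all_goals
    ext i j
    simp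

/-- The inclusion of `SU(m)` into `O(2m)`. -/
def realSU (m : ℕ) :
    Matrix.specialUnitaryGroup (Fin m) ℂ →* Matrix.orthogonalGroup (Fin (2 * m)) ℝ where
  toFun A := ⟨realMatrix (A : Matrix (Fin m) (Fin m) ℂ), by
    have h : (A : Matrix (Fin m) (Fin m) ℂ) ∈ Matrix.unitaryGroup (Fin m) ℂ := A.2.1
    rw [Matrix.mem_unitaryGroup_iff] at h
    refine Matrix.mem_unitaryGroup_iff.mpr ?_
    rw [← realMatrix_star, ← realMatrix_mul, h, realMatrix_one]⟩
  map_one' := Subtype.ext (realMatrix_one m)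
  map_mul' A B := Subtype.ext (realMatrix_mul (A : Matrix (Fin m) (Fin m) ℂ) B)

/-- `SU(m)` as a subgroup of `O(2m)`. -/
def SU (m : ℕ) : Subgroup (Matrix.orthogonalGroup (Fin (2 * m)) ℝ) :=
  (realSU m).range

/-- The `(p + q) × (p + q)` block diagonal matrix with diagonal blocks `a` and `b`. -/
def blockDiag {p q : ℕ} (a : Matrix (Fin p) (Fin p) ℂ) (b : Matrix (Fin q) (Fin q) ℂ) :
    Matrix (Fin (p + q)) (Fin (p + q)) ℂ :=
  Matrix.reindex finSumFinEquiv finSumFinEquiv (Matrix.fromBlocks a 0 0 b)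

/-- `S(U(p) × U(q))`: the elements of `SU(p + q)` that are block diagonal with blocks in `U(p)`
and `U(q)`. -/
def SUU (p q : ℕ) : Subgroup (Matrix.specialUnitaryGroup (Fin (p + q)) ℂ) where
  carrier := {x | ∃ a ∈ Matrix.unitaryGroup (Fin p) ℂ, ∃ b ∈ Matrix.unitaryGroup (Fin q) ℂ,
    (x : Matrix (Fin (p + q)) (Fin (p + q)) ℂ) = blockDiag a b}
  one_mem' := ⟨1, one_mem _, 1, one_mem _, by simp [blockDiag]⟩
  mul_mem' := by
    rintro x y ⟨a, ha, b, hb, hx⟩ ⟨c, hc, d, hd, hy⟩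
    refine ⟨a * c, mul_mem ha hc, b * d, mul_mem hb hd, ?_⟩
    rw [Submonoid.coe_mul, hx, hy]
    simp only [blockDiag, Matrix.reindex_apply]
    rw [Matrix.submatrix_mul_equiv, Matrix.fromBlocks_multiply]
    simp
  inv_mem' := by
    rintro x ⟨a, ha, b, hb, hx⟩
    refine ⟨star a, Unitary.star_mem ha, star b, Unitary.star_mem hb, ?_⟩
    rw [← Matrix.star_eq_inv, Matrix.specialUnitaryGroup.coe_star, hx]
    simp [blockDiag, Matrix.star_eq_conjTranspose, Matrix.fromBlocks_conjTranspose]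

/-- The true gauge group of the Standard Model `𝒢 = S(U(3) × U(2)) ⊆ SU(5) ⊆ O(10)`. -/
def gaugeGroup : Subgroup (Matrix.orthogonalGroup (Fin 10) ℝ) :=
  (SUU 3 2).map (realSU 5)

/-! ### Riemannian metrics -/

section Metric

variable {E : Type*} [NormedAddCommGroup E] [NormedSpace ℝ E]
  {H : Type*} [TopologicalSpace H] (I : ModelWithCorners ℝ E H)
  (M : Type*) [TopologicalSpace M] [ChartedSpace H M] [IsManifold I ∞ M]

/-- Smooth Riemannian metrics on a smooth manifold. -/
abbrev SmoothMetric := ContMDiffRiemannianMetric I ∞ E (fun x : M ↦ TangentSpace I x)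

variable {I M} in
theorem metric_nonneg (g : SmoothMetric I M) (x : M) (v : TangentSpace I x) :
    0 ≤ g.inner x v v := by
  by_cases h : v = 0
  · simp [h]
  · exact (g.pos x v h).le

end Metric

section Product

variable {E : Type*} [NormedAddCommGroup E] [NormedSpace ℝ E]
  {H : Type*} [TopologicalSpace H] {I : ModelWithCorners ℝ E H}
  {M : Type*} [TopologicalSpace M] [ChartedSpace H M] [IsManifold I ∞ M]
  {F : Type*} [NormedAddCommGroup F] [NormedSpace ℝ F]
  {H' : Type*} [TopologicalSpace H'] {J : ModelWithCorners ℝ F H'}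
  {K : Type*} [TopologicalSpace K] [ChartedSpace H' K] [IsManifold J ∞ K]

/-- The pull-back of a bilinear form on a tangent space under a smooth map `f`:
`(u, v) ↦ B (df u, df v)`. -/
def pullbackForm (f : M → K) (x : M)
    (B : TangentSpace J (f x) →L[ℝ] TangentSpace J (f x) →L[ℝ] ℝ) :
    TangentSpace I x →L[ℝ] TangentSpace I x →L[ℝ] ℝ :=
  (ContinuousLinearMap.precomp ℝ (mfderiv I J f x)).comp (B.comp (mfderiv I J f x))

theorem contMDiff_pullbackForm {f : M → K} (hf : ContMDiff I J ∞ f)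
    (g : ∀ y : K, TangentSpace J y →L[ℝ] TangentSpace J y →L[ℝ] ℝ)
    (hg : ContMDiff J (J.prod 𝓘(ℝ, F →L[ℝ] F →L[ℝ] ℝ)) ∞
      (fun y ↦ TotalSpace.mk' (F →L[ℝ] F →L[ℝ] ℝ)
        (E := fun y : K ↦ TangentSpace J y →L[ℝ] TangentSpace J y →L[ℝ] ℝ) y (g y))) :
    ContMDiff I (I.prod 𝓘(ℝ, E →L[ℝ] E →L[ℝ] ℝ)) ∞
      (fun x ↦ TotalSpace.mk' (E →L[ℝ] E →L[ℝ] ℝ)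
        (E := fun x : M ↦ TangentSpace I x →L[ℝ] TangentSpace I x →L[ℝ] ℝ) x
        (pullbackForm f x (g (f x)))) := by
  intro x₀
  rw [contMDiffAt_hom_bundle]
  refine ⟨contMDiffAt_id, ?_⟩
  have hG := (hg (f x₀))
  rw [contMDiffAt_hom_bundle] at hG
  have hG' := hG.2.comp x₀ hf.contMDiffAt
  have hφ := (hf.contMDiffAt (x := x₀)).mfderiv_const (m := ∞) (by simp)
  have h1 := (hφ.clm_precomp (F₃ := ℝ)).clm_comp (hG'.clm_comp hφ)
  refine h1.congr_of_eventuallyEq ?_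
  have hU : (trivializationAt E (TangentSpace I : M → Type _) x₀).baseSet ∈ nhds x₀ :=
    (trivializationAt E (TangentSpace I : M → Type _) x₀).open_baseSet.mem_nhds
      (FiberBundle.mem_baseSet_trivializationAt' x₀)
  have hV : f ⁻¹' (trivializationAt F (TangentSpace J : K → Type _) (f x₀)).baseSet ∈ nhds x₀ :=
    hf.continuous.continuousAt.preimage_mem_nhds
      ((trivializationAt F (TangentSpace J : K → Type _) (f x₀)).open_baseSet.mem_nhds
        (FiberBundle.mem_baseSet_trivializationAt' (f x₀)))
  filter_upwards [hU, hV] with x hx hy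
  ext u v
  have hy' : f x ∈ (trivializationAt F (TangentSpace J : K → Type _) (f x₀)).baseSet := hy
  have e1 : ∀ w : E, (trivializationAt F (TangentSpace J : K → Type _) (f x₀)).symm (f x)
      (inTangentCoordinates I J id f (fun x ↦ mfderiv I J f x) x₀ x w) =
      mfderiv I J f x ((trivializationAt E (TangentSpace I : M → Type _) x₀).symm x w) := by
    intro w
    have e0 : inTangentCoordinates I J id f (fun x ↦ mfderiv I J f x) x₀ x w =
        (trivializationAt F (TangentSpace J : K → Type _) (f x₀)).continuousLinearMapAt ℝ (f x)
          (mfderiv I J f x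
            ((trivializationAt E (TangentSpace I : M → Type _) x₀).symmL ℝ x w)) := rfl
    rw [e0, ← Trivialization.symmL_apply (R := ℝ) _ hy',
      Trivialization.symmL_continuousLinearMapAt _ hy', Trivialization.symmL_apply (R := ℝ) _ hx]
  simp
  rw [inCoordinates_apply_eq₂ hx hx (by simp)]
  rw [inCoordinates_apply_eq₂ hy' hy' (by simp)]
  rw [e1, e1]
  simp [pullbackForm]

set_option linter.unusedSectionVars false in
theorem prodForm_apply (p : M × K)
    (A : TangentSpace I p.1 →L[ℝ] TangentSpace I p.1 →L[ℝ] ℝ)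
    (B : TangentSpace J p.2 →L[ℝ] TangentSpace J p.2 →L[ℝ] ℝ)
    (v w : TangentSpace (I.prod J) p) :
    (pullbackForm (I := I.prod J) (J := I) Prod.fst p A +
      pullbackForm (I := I.prod J) (J := J) Prod.snd p B) v w =
      A v.1 w.1 + B v.2 w.2 := by
  have h1 : pullbackForm (I := I.prod J) (J := I) Prod.fst p A v w =
      A (mfderiv (I.prod J) I Prod.fst p v) (mfderiv (I.prod J) I Prod.fst p w) := rfl
  have h2 : pullbackForm (I := I.prod J) (J := J) Prod.snd p B v w =
      B (mfderiv (I.prod J) J Prod.snd p v) (mfderiv (I.prod J) J Prod.snd p w) := rfl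
  rw [mfderiv_fst] at h1
  rw [mfderiv_snd] at h2
  exact congrArg₂ (· + ·) h1 h2

set_option synthInstance.maxHeartbeats 200000 in
set_option maxHeartbeats 1000000 in
/-- The product metric on `M × K`: the sum of the pull-backs of the two metrics under the
projections. -/
def SmoothMetric.prod (g : SmoothMetric I M) (k : SmoothMetric J K) :
    SmoothMetric (I.prod J) (M × K) where
  inner p := pullbackForm Prod.fst p (g.inner p.1) + pullbackForm Prod.snd p (k.inner p.2)
  symm p v w := by
    refine (prodForm_apply p _ _ v w).trans (Eq.trans ?_ (prodForm_apply p _ _ w v).symm)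
    exact congrArg₂ (· + ·) (g.symm p.1 v.1 w.1) (k.symm p.2 v.2 w.2)
  pos p v hv := by
    refine lt_of_lt_of_eq ?_ (prodForm_apply p _ _ v v).symm
    by_cases h : v.1 = 0
    · have h2 : v.2 ≠ 0 := fun h2 ↦ hv (Prod.ext h h2)
      exact add_pos_of_nonneg_of_pos (metric_nonneg g p.1 v.1) (k.pos p.2 v.2 h2)
    · exact add_pos_of_pos_of_nonneg (g.pos p.1 v.1 h) (metric_nonneg k p.2 v.2)
  isVonNBounded p := by
    have h1 : Bornology.IsBounded (show Set E from {v : E | g.inner p.1 v v < 1}) :=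
      (NormedSpace.isVonNBounded_iff ℝ).1 (g.isVonNBounded p.1)
    have h2 : Bornology.IsBounded (show Set F from {v : F | k.inner p.2 v v < 1}) :=
      (NormedSpace.isVonNBounded_iff ℝ).1 (k.isVonNBounded p.2)
    refine ((NormedSpace.isVonNBounded_iff ℝ (E := E × F)).2 (h1.prod h2)).subset ?_
    intro v hv
    have hv' : g.inner p.1 v.1 v.1 + k.inner p.2 v.2 v.2 < 1 :=
      lt_of_eq_of_lt (prodForm_apply p _ _ v v).symm hv
    exact ⟨lt_of_le_of_lt (le_add_of_nonneg_right (metric_nonneg k p.2 v.2)) hv',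
      lt_of_le_of_lt (le_add_of_nonneg_left (metric_nonneg g p.1 v.1)) hv'⟩
  contMDiff := by
    have h1 := contMDiff_pullbackForm (contMDiff_fst (I := I) (J := J) (M := M) (N := K) (n := ∞))
      g.inner g.contMDiff
    have h2 := contMDiff_pullbackForm (contMDiff_snd (I := I) (J := J) (M := M) (N := K) (n := ∞))
      k.inner k.contMDiff
    exact ContMDiff.add_section h1 h2

end Product

/-! ### Levi-Civita parallel transport and holonomy -/

section Holonomy

variable {E : Type*} [NormedAddCommGroup E] [NormedSpace ℝ E]
  {H : Type*} [TopologicalSpace H] {I : ModelWithCorners ℝ E H}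
  {M : Type*} [TopologicalSpace M] [ChartedSpace H M] [IsManifold I ∞ M]

/-- The metric in the chart at `p`: the value `g_{ij}(y) u^i v^j` at the point with coordinates
`y`, on the vectors with coordinates `u` and `v`. -/
def metricInChart (g : SmoothMetric I M) (p : M) (y u v : E) : ℝ :=
  g.inner ((extChartAt I p).symm y)
    (mfderiv 𝓘(ℝ, E) I (extChartAt I p).symm y u)
    (mfderiv 𝓘(ℝ, E) I (extChartAt I p).symm y v)

/-- The Christoffel symbols of the first kind of the Levi-Civita connection in the chart at `p`:
`Γ_{ijl}(y) u^i v^j w^l` with `Γ_{ijl} = (∂_i g_{jl} + ∂_j g_{il} - ∂_l g_{ij}) / 2`. In other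
words, `g(∇_u v, w)` for vector fields `u`, `v`, `w` that are constant in the chart. -/
def christoffel (g : SmoothMetric I M) (p : M) (y u v w : E) : ℝ :=
  (fderiv ℝ (fun z ↦ metricInChart g p z v w) y u +
    fderiv ℝ (fun z ↦ metricInChart g p z u w) y v -
    fderiv ℝ (fun z ↦ metricInChart g p z u v) y w) / 2

/-- A vector field `V` along a curve (a curve in the tangent bundle) satisfies the equation
`∇V/dt = 0` of parallel transport at time `t`. In the chart at the base point of `V t`, if `x` is
the coordinate expression of the curve and `c` that of the vector field, this is the equation
`dc^k/dt + Γ^k_{ij} (dx^i/dt) c^j = 0`, here with the index `k` lowered by the metric. -/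
def IsParallelAt (g : SmoothMetric I M) (V : ℝ → TangentBundle I M) (t : ℝ) : Prop :=
  ∃ x' c' : E,
    HasDerivAt (fun s ↦ extChartAt I (V t).proj (V s).proj) x' t ∧
    HasDerivAt
      (fun s ↦ (mfderiv I 𝓘(ℝ, E) (extChartAt I (V t).proj) (V s).proj (V s).2 : E)) c' t ∧
    ∀ w : E,
      metricInChart g (V t).proj (extChartAt I (V t).proj (V t).proj) c' w +
        christoffel g (V t).proj (extChartAt I (V t).proj (V t).proj) x'
          (mfderiv I 𝓘(ℝ, E) (extChartAt I (V t).proj) (V t).proj (V t).2 : E) w = 0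

/-- The points `τ 0 < ... < τ N` form a subdivision of `[0, 1]`. -/
def IsSubdivision {N : ℕ} (τ : Fin (N + 1) → ℝ) : Prop :=
  StrictMono τ ∧ τ 0 = 0 ∧ τ (Fin.last N) = 1

/-- `γ` restricted to `[0, 1]` is a piecewise smooth curve, smooth on each closed interval of the
subdivision `τ`. -/
def IsPiecewiseSmooth (I : ModelWithCorners ℝ E H) [IsManifold I ∞ M] {N : ℕ}
    (τ : Fin (N + 1) → ℝ) (γ : ℝ → M) : Prop :=
  IsSubdivision τ ∧
    ∀ i : Fin N, ContMDiffOn 𝓘(ℝ, ℝ) I ∞ γ (Icc (τ i.castSucc) (τ i.succ))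

/-- `V` is a parallel vector field along the piecewise smooth curve `γ` on `[0, 1]`: it is
continuous, and parallel on each interval of the subdivision `τ`. -/
def IsParallelAlong (g : SmoothMetric I M) {N : ℕ} (τ : Fin (N + 1) → ℝ) (γ : ℝ → M)
    (V : ℝ → TangentBundle I M) : Prop :=
  (∀ t ∈ Icc (0 : ℝ) 1, (V t).proj = γ t) ∧ ContinuousOn V (Icc 0 1) ∧
    ∀ i : Fin N, ∀ t ∈ Ioo (τ i.castSucc) (τ i.succ), IsParallelAt g V t

/-- The holonomy group at `x`: all linear automorphisms `P` of the tangent space at `x` that are the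
parallel transport around some piecewise smooth loop `γ` based at `x`, that is, each vector `v` at
`x` is the start of a parallel vector field along `γ` that ends in `P v`. -/
def holonomyGroup (g : SmoothMetric I M) (x : M) :
    Set (TangentSpace I x ≃ₗ[ℝ] TangentSpace I x) :=
  {P | ∃ (N : ℕ) (τ : Fin (N + 1) → ℝ) (γ : ℝ → M),
    IsPiecewiseSmooth I τ γ ∧ γ 0 = x ∧ γ 1 = x ∧
      ∀ v : TangentSpace I x, ∃ V : ℝ → TangentBundle I M,
        IsParallelAlong g τ γ V ∧ V 0 = ⟨x, v⟩ ∧ V 1 = ⟨x, P v⟩}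

/-- For a subgroup `G` of `O(n)`, a `G`-manifold is an `n`-dimensional Riemannian manifold whose
holonomy group at each point is contained in `G`, when the tangent space is identified with `ℝ^n`
by a suitable orthonormal basis. -/
def IsGManifold {n : ℕ} (G : Subgroup (Matrix.orthogonalGroup (Fin n) ℝ))
    (g : SmoothMetric I M) : Prop :=
  Module.finrank ℝ E = n ∧
    ∀ x : M, ∃ b : Module.Basis (Fin n) ℝ (TangentSpace I x),
      (∀ i j, g.inner x (b i) (b j) = if i = j then 1 else 0) ∧
      ∀ P ∈ holonomyGroup g x, ∃ A ∈ G,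
        LinearMap.toMatrix b b (P : TangentSpace I x →ₗ[ℝ] TangentSpace I x) =
          (A : Matrix (Fin n) (Fin n) ℝ)

/-- A Calabi-Yau manifold of real dimension `2m`: an `SU(m)`-manifold. -/
def IsCalabiYau (m : ℕ) (g : SmoothMetric I M) : Prop :=
  IsGManifold (SU m) g

end Holonomy

end HolonomyReduction

end

/-!
# The product of Calabi-Yau manifolds of real dimensions `4` and `6`

The holonomy of a Riemannian product is contained in the product of the holonomy groups of the
factors, and `SU(3) × SU(2)` is contained in `S(U(3) × U(2))`.

For the first fact, the metric of `M × K` in a product chart is the sum of the metrics of the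
factors, hence so are the Christoffel symbols of the first kind (`metricInChart_prod`,
`christoffel_prod`). Testing the equation of parallel transport against vectors `(w, 0)` and
`(0, w)` shows that the two components of a parallel vector field are parallel along the components
of the curve (`IsParallelAlong.fstCurve`, `IsParallelAlong.sndCurve`). What remains is that the end
value of each component depends only on its own start value. By linearity this says that a parallel
field on a factor which starts at zero ends at zero, and that follows from metric compatibility: the
squared length of a parallel field has derivative zero between the points of the subdivision and is
continuous (`IsParallelAlong.inner_self_eq`). So a parallel transport around a loop in `M × K` is a
product `P₁ × P₂` of parallel transports around its projections
(`exists_mem_holonomyGroup_of_mem_prod`).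

For the second fact, `realMatrix_blockDiag` compares the real matrix of a complex block diagonal
matrix with the block diagonal matrix of the real matrices. They agree up to a reordering
`blockEquiv` of the basis, both because all real parts precede all imaginary parts in `ℝ^(2m)` and
because the first block belongs to the second factor `K`. The orthonormal bases of the factors are
put together along the same reordering (`IsCalabiYau.prod`).
-/

namespace HolonomyReduction

/-! ### The metric and the Christoffel symbols in a chart -/

/-- The product rule for a variable bilinear form evaluated on a variable vector. -/
theorem hasDerivAt_bilinear_self {E : Type*} [NormedAddCommGroup E] [NormedSpace ℝ E]
    {G : E → E →L[ℝ] E →L[ℝ] ℝ} {x c : ℝ → E} {x' c' : E} {t : ℝ}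
    (hG : DifferentiableAt ℝ G (x t)) (hx : HasDerivAt x x' t) (hc : HasDerivAt c c' t) :
    HasDerivAt (fun s ↦ G (x s) (c s) (c s))
      (fderiv ℝ G (x t) x' (c t) (c t) + G (x t) c' (c t) + G (x t) (c t) c') t := by
  have h1 : HasDerivAt (fun s ↦ G (x s)) (fderiv ℝ G (x t) x') t :=
    HasFDerivAt.comp_hasDerivAt (E := E →L[ℝ] E →L[ℝ] ℝ) t hG.hasFDerivAt hx
  exact (h1.clm_apply hc).clm_apply hc

section Chart

variable {E : Type*} [NormedAddCommGroup E] [NormedSpace ℝ E]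
  {H : Type*} [TopologicalSpace H] {I : ModelWithCorners ℝ E H}
  {M : Type*} [TopologicalSpace M] [ChartedSpace H M] [IsManifold I ∞ M]

/-- The metric in the chart at `p` as a field of continuous bilinear forms on the model space; its
values are those of `metricInChart`. -/
noncomputable def chartForm (g : SmoothMetric I M) (p : M) (y : E) : E →L[ℝ] E →L[ℝ] ℝ :=
  pullbackForm (I := 𝓘(ℝ, E)) (J := I) (extChartAt I p).symm y
    (g.inner ((extChartAt I p).symm y))

theorem chartForm_apply (g : SmoothMetric I M) (p : M) (y u v : E) :
    chartForm g p y u v = metricInChart g p y u v := rfl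

theorem metricInChart_comm (g : SmoothMetric I M) (p : M) (y u v : E) :
    metricInChart g p y u v = metricInChart g p y v u :=
  g.symm _ _ _

/-- The coordinate expressions of two vectors compute their scalar product. -/
theorem metricInChart_extChartAt [I.Boundaryless] (g : SmoothMetric I M) (p : M) {q : M}
    (hq : q ∈ (extChartAt I p).source) (v w : TangentSpace I q) :
    metricInChart g p (extChartAt I p q) (mfderiv I 𝓘(ℝ, E) (extChartAt I p) q v)
      (mfderiv I 𝓘(ℝ, E) (extChartAt I p) q w) = g.inner q v w := by
  have h := mfderivWithin_extChartAt_symm_comp_mfderiv_extChartAt' (I := I) hq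
  rw [I.range_eq_univ, mfderivWithin_univ] at h
  -- The forms at `φ⁻¹ (φ q)` and at `q` have different types; they are compared as forms on `E`.
  have key : ∀ q', q' = q → ∀ a b : E, (g.inner q' : E →L[ℝ] E →L[ℝ] ℝ) a b =
      (g.inner q : E →L[ℝ] E →L[ℝ] ℝ) a b := by
    rintro q' rfl a b; rfl
  refine (key _ ((extChartAt I p).left_inv hq) _ _).trans ?_
  exact congrArg₂ (fun a b : E ↦ (g.inner q : E →L[ℝ] E →L[ℝ] ℝ) a b)
    (DFunLike.congr_fun h v) (DFunLike.congr_fun h w)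

/-- Only the centre of the chart is needed, because `IsParallelAt` always uses the chart at the
current base point. On that chart the derivative of the inverse chart is the inverse of the preferred
trivialization of the tangent bundle, so that smoothness of the metric as a section applies. -/
theorem differentiableAt_chartForm [I.Boundaryless] (g : SmoothMetric I M) (p : M) :
    DifferentiableAt ℝ (chartForm g p) (extChartAt I p p) := by
  have hg := g.contMDiff p
  rw [contMDiffAt_hom_bundle] at hg
  have hs : ContMDiffAt 𝓘(ℝ, E) I ∞ (extChartAt I p).symm (extChartAt I p p) :=
    (contMDiffOn_extChartAt_symm p).contMDiffAt (extChartAt_target_mem_nhds p)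
  have h2 := hg.2
  simp only at h2
  rw [← extChartAt_to_inv (I := I) p] at h2
  have h3 := (h2.comp _ hs).contDiffAt.differentiableAt (by simp)
  simp only [extChartAt_to_inv] at h3
  refine h3.congr_of_eventuallyEq ?_
  filter_upwards [extChartAt_target_mem_nhds (I := I) p] with y hy
  have hq : (extChartAt I p).symm y ∈ (chartAt H p).source := by
    rw [← extChartAt_source (I := I)]; exact (extChartAt I p).map_target hy
  have hb : (extChartAt I p).symm y ∈
      (trivializationAt E (TangentSpace I : M → Type _) p).baseSet := by
    simpa using hq
  have h4 := TangentBundle.symmL_trivializationAt (I := I) hq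
  rw [I.range_eq_univ, mfderivWithin_univ, (extChartAt I p).right_inv hy] at h4
  ext u v
  simp only [Function.comp_apply]
  rw [inCoordinates_apply_eq₂ hb hb (by simp)]
  rw [← Trivialization.symmL_apply (R := ℝ) _ hb, ← Trivialization.symmL_apply (R := ℝ) _ hb, h4]
  exact (DFunLike.congr_fun (Bundle.Trivial.linearMapAt_trivialization ℝ M ℝ
    ((extChartAt I p).symm y)) _).symm

theorem differentiableAt_metricInChart [I.Boundaryless] (g : SmoothMetric I M) (p : M) (u v : E) :
    DifferentiableAt ℝ (fun y ↦ metricInChart g p y u v) (extChartAt I p p) :=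
  ((differentiableAt_chartForm g p).clm_apply (differentiableAt_const u)).clm_apply
    (differentiableAt_const v)

theorem fderiv_metricInChart [I.Boundaryless] (g : SmoothMetric I M) (p : M) (u v w : E) :
    fderiv ℝ (fun y ↦ metricInChart g p y u v) (extChartAt I p p) w =
      fderiv ℝ (chartForm g p) (extChartAt I p p) w u v := by
  have h := (((differentiableAt_chartForm g p).hasFDerivAt.clm_apply
    (hasFDerivAt_const u _)).clm_apply (hasFDerivAt_const v _)).fderiv
  have h' := DFunLike.congr_fun h w
  simpa using! h'

/-- Metric compatibility of the Levi-Civita connection, `g(∇_u v, v) = ∂_u g(v, v) / 2`: the other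
two terms of the Christoffel symbol cancel. -/
theorem christoffel_self (g : SmoothMetric I M) (p : M) (y u v : E) :
    christoffel g p y u v v = fderiv ℝ (fun z ↦ metricInChart g p z v v) y u / 2 := by
  unfold christoffel
  ring

/-- The squared length of a parallel vector field has derivative `2 g(∇V/dt, V) = 0`. -/
theorem IsParallelAt.hasDerivAt_inner_self [I.Boundaryless] {g : SmoothMetric I M}
    {V : ℝ → TangentBundle I M} {t : ℝ} (hV : IsParallelAt g V t)
    (hc : ContinuousAt (fun s ↦ (V s).proj) t) :
    HasDerivAt (fun s ↦ g.inner (V s).proj (V s).2 (V s).2) 0 t := by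
  obtain ⟨x', c', hx, hcd, heq⟩ := hV
  set p := (V t).proj with hp
  set c : ℝ → E := fun s ↦ mfderiv I 𝓘(ℝ, E) (extChartAt I p) (V s).proj (V s).2 with hcdef
  have h2 := hasDerivAt_bilinear_self (differentiableAt_chartForm g p) hx hcd
  have hnhds : ∀ᶠ s in nhds t, (V s).proj ∈ (extChartAt I p).source :=
    hc.eventually (extChartAt_source_mem_nhds (I := I) p)
  refine (h2.congr_of_eventuallyEq ?_).congr_deriv ?_
  · filter_upwards [hnhds] with s hs
    exact (metricInChart_extChartAt g p hs _ _).symm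
  · -- The equation of parallel transport, tested against the vector field itself.
    have e := heq (c t)
    have e' := christoffel_self g p (extChartAt I p p) x' (c t)
    have e'' := fderiv_metricInChart g p (c t) (c t) x'
    have e3 := metricInChart_comm g p (extChartAt I p p) (c t) c'
    simp only [chartForm_apply, ← hp] at *
    change _ + christoffel g p (extChartAt I p p) x' (c t) (c t) = 0 at e
    rw [e', e''] at e
    change (fderiv ℝ (chartForm g p) (extChartAt I p p) x' (c t) (c t) +
      metricInChart g p (extChartAt I p p) c' (c t)) +
      metricInChart g p (extChartAt I p p) (c t) c' = 0
    rw [e3]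
    linarith

theorem continuous_inner_self (g : SmoothMetric I M) :
    Continuous (fun v : TangentBundle I M ↦ g.inner v.proj v.2 v.2) := by
  have hg : Continuous fun v : TangentBundle I M ↦
      TotalSpace.mk' (E →L[ℝ] E →L[ℝ] ℝ)
        (E := fun x : M ↦ TangentSpace I x →L[ℝ] TangentSpace I x →L[ℝ] ℝ) v.proj
        (g.inner v.proj) :=
    g.contMDiff.continuous.comp (FiberBundle.continuous_proj E (TangentSpace I : M → Type _))
  have hv : Continuous fun v : TangentBundle I M ↦
      TotalSpace.mk' E (E := fun x : M ↦ TangentSpace I x) v.proj v.2 := continuous_id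
  rw [continuous_iff_continuousAt]
  intro v
  have := (hg.continuousAt (x := v)).clm_bundle_apply₂ (F₁ := E) (F₂ := E) (F₃ := ℝ)
    (E₁ := fun x : M ↦ TangentSpace I x) (E₂ := fun x : M ↦ TangentSpace I x)
    (E₃ := Bundle.Trivial M ℝ) hv.continuousAt hv.continuousAt
  simp only [FiberBundle.continuousAt_totalSpace] at this
  exact this.2

/-! ### Parallel transport preserves lengths -/

theorem IsSubdivision.zero_le {N : ℕ} {τ : Fin (N + 1) → ℝ} (h : IsSubdivision τ)
    (i : Fin (N + 1)) : 0 ≤ τ i :=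
  h.2.1 ▸ h.1.monotone (Fin.zero_le i)

theorem IsSubdivision.le_one {N : ℕ} {τ : Fin (N + 1) → ℝ} (h : IsSubdivision τ)
    (i : Fin (N + 1)) : τ i ≤ 1 :=
  h.2.2 ▸ h.1.monotone (Fin.le_last i)

theorem IsSubdivision.mem_nhds {N : ℕ} {τ : Fin (N + 1) → ℝ} (h : IsSubdivision τ)
    {i : Fin N} {t : ℝ} (ht : t ∈ Ioo (τ i.castSucc) (τ i.succ)) : Icc (0 : ℝ) 1 ∈ nhds t :=
  Icc_mem_nhds ((h.zero_le _).trans_lt ht.1) (ht.2.trans_le (h.le_one _))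

theorem IsParallelAlong.continuousAt_proj {g : SmoothMetric I M} {N : ℕ} {τ : Fin (N + 1) → ℝ}
    {γ : ℝ → M} {V : ℝ → TangentBundle I M} (hV : IsParallelAlong g τ γ V)
    (hτ : IsSubdivision τ) {i : Fin N} {t : ℝ} (ht : t ∈ Ioo (τ i.castSucc) (τ i.succ)) :
    ContinuousAt (fun s ↦ (V s).proj) t :=
  (FiberBundle.continuous_proj E (TangentSpace I : M → Type _)).continuousAt.comp
    (hV.2.1.continuousAt (hτ.mem_nhds ht))

/-- Parallel transport preserves the length of vectors. -/
theorem IsParallelAlong.inner_self_eq [I.Boundaryless] {g : SmoothMetric I M} {N : ℕ}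
    {τ : Fin (N + 1) → ℝ} {γ : ℝ → M} {V : ℝ → TangentBundle I M}
    (hV : IsParallelAlong g τ γ V) (hτ : IsSubdivision τ) :
    g.inner (V 1).proj (V 1).2 (V 1).2 = g.inner (V 0).proj (V 0).2 (V 0).2 := by
  set f : ℝ → ℝ := fun s ↦ g.inner (V s).proj (V s).2 (V s).2 with hf
  have hfc : ContinuousOn f (Icc 0 1) := (continuous_inner_self g).comp_continuousOn hV.2.1
  have hstep : ∀ i : Fin N, f (τ i.succ) = f (τ i.castSucc) := by
    intro i
    have hlt : τ i.castSucc < τ i.succ := hτ.1 Fin.castSucc_lt_succ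
    obtain ⟨t, ht, hslope⟩ := exists_hasDerivAt_eq_slope f (fun _ ↦ 0) hlt
      (hfc.mono (Icc_subset_Icc (hτ.zero_le _) (hτ.le_one _)))
      (fun t ht ↦ (hV.2.2 i t ht).hasDerivAt_inner_self
        (hV.continuousAt_proj hτ ht))
    rw [eq_comm, div_eq_zero_iff] at hslope
    rcases hslope with h | h <;> linarith
  have hall : ∀ i : Fin (N + 1), f (τ i) = f (τ 0) := by
    intro i
    induction i using Fin.induction with
    | zero => rfl
    | succ i ih => rw [hstep, ih]
  have := hall (Fin.last N)
  rwa [hτ.2.1, hτ.2.2] at this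

theorem eq_zero_of_inner_self_eq_zero (g : SmoothMetric I M) {x : M} {v : TangentSpace I x}
    (h : g.inner x v v = 0) : v = 0 := by
  by_contra hv
  exact (g.pos x v hv).ne' h

/-- Injectivity of parallel transport in the form used for products; it follows from preservation
of lengths, without the uniqueness theorem for ordinary differential equations. -/
theorem IsParallelAlong.eq_zero [I.Boundaryless] {g : SmoothMetric I M} {N : ℕ}
    {τ : Fin (N + 1) → ℝ} {γ : ℝ → M} {V : ℝ → TangentBundle I M}
    (hV : IsParallelAlong g τ γ V) (hτ : IsSubdivision τ) (h : (V 0).2 = 0) : (V 1).2 = 0 := by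
  refine eq_zero_of_inner_self_eq_zero g ((hV.inner_self_eq hτ).trans ?_)
  rw [h, map_zero]

end Chart

/-! ### Product charts -/

section ProductChart

variable {E : Type*} [NormedAddCommGroup E] [NormedSpace ℝ E]
  {H : Type*} [TopologicalSpace H] {I : ModelWithCorners ℝ E H}
  {M : Type*} [TopologicalSpace M] [ChartedSpace H M] [IsManifold I ∞ M]
  {F : Type*} [NormedAddCommGroup F] [NormedSpace ℝ F]
  {H' : Type*} [TopologicalSpace H'] {J : ModelWithCorners ℝ F H'}
  {K : Type*} [TopologicalSpace K] [ChartedSpace H' K] [IsManifold J ∞ K]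

/-- Stated for the components, since the chart of the product takes values in `E × F` with the model
`𝓘(ℝ, E × F)`, which is not syntactically a product of models with corners. -/
theorem mfderiv_extChartAt_prod_fst (p : M × K) {q : M × K}
    (hq : q ∈ (extChartAt (I.prod J) p).source) (v : TangentSpace (I.prod J) q) :
    (mfderiv (I.prod J) 𝓘(ℝ, E × F) (extChartAt (I.prod J) p) q v : E × F).1 =
      (mfderiv I 𝓘(ℝ, E) (extChartAt I p.1) q.1 v.1 : E) := by
  have hq' : q.1 ∈ (extChartAt I p.1).source := by
    rw [extChartAt_prod] at hq; exact hq.1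
  have hΦ : MDifferentiableAt (I.prod J) 𝓘(ℝ, E × F) (extChartAt (I.prod J) p) q :=
    mdifferentiableAt_extChartAt (by rwa [extChartAt_source] at hq)
  have hφ : MDifferentiableAt I 𝓘(ℝ, E) (extChartAt I p.1) q.1 :=
    mdifferentiableAt_extChartAt (by rwa [extChartAt_source] at hq')
  have h1 := mfderiv_comp_apply (I := I.prod J) (I' := 𝓘(ℝ, E × F)) (I'' := 𝓘(ℝ, E)) q
    (g := (Prod.fst : E × F → E)) differentiableAt_fst.mdifferentiableAt hΦ v
  have h2 := mfderiv_comp_apply (I := I.prod J) (I' := I) (I'' := 𝓘(ℝ, E)) q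
    (f := (Prod.fst : M × K → M)) hφ mdifferentiableAt_fst v
  have h3 : (Prod.fst : E × F → E) ∘ extChartAt (I.prod J) p =
      extChartAt I p.1 ∘ (Prod.fst : M × K → M) := by
    rw [extChartAt_prod]; rfl
  rw [h3, h2, mfderiv_fst, mfderiv_eq_fderiv, fderiv_fst] at h1
  exact h1.symm

theorem mfderiv_extChartAt_prod_snd (p : M × K) {q : M × K}
    (hq : q ∈ (extChartAt (I.prod J) p).source) (v : TangentSpace (I.prod J) q) :
    (mfderiv (I.prod J) 𝓘(ℝ, E × F) (extChartAt (I.prod J) p) q v : E × F).2 =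
      (mfderiv J 𝓘(ℝ, F) (extChartAt J p.2) q.2 v.2 : F) := by
  have hq' : q.2 ∈ (extChartAt J p.2).source := by
    rw [extChartAt_prod] at hq; exact hq.2
  have hΦ : MDifferentiableAt (I.prod J) 𝓘(ℝ, E × F) (extChartAt (I.prod J) p) q :=
    mdifferentiableAt_extChartAt (by rwa [extChartAt_source] at hq)
  have hψ : MDifferentiableAt J 𝓘(ℝ, F) (extChartAt J p.2) q.2 :=
    mdifferentiableAt_extChartAt (by rwa [extChartAt_source] at hq')
  have h1 := mfderiv_comp_apply (I := I.prod J) (I' := 𝓘(ℝ, E × F)) (I'' := 𝓘(ℝ, F)) q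
    (g := (Prod.snd : E × F → F)) differentiableAt_snd.mdifferentiableAt hΦ v
  have h2 := mfderiv_comp_apply (I := I.prod J) (I' := J) (I'' := 𝓘(ℝ, F)) q
    (f := (Prod.snd : M × K → K)) hψ mdifferentiableAt_snd v
  have h3 : (Prod.snd : E × F → F) ∘ extChartAt (I.prod J) p =
      extChartAt J p.2 ∘ (Prod.snd : M × K → K) := by
    rw [extChartAt_prod]; rfl
  rw [h3, h2, mfderiv_snd, mfderiv_eq_fderiv, fderiv_snd] at h1
  exact h1.symm

theorem mdifferentiableAt_extChartAt_symm_of_mem_target [I.Boundaryless] (p : M) {y : E}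
    (hy : y ∈ (extChartAt I p).target) :
    MDifferentiableAt 𝓘(ℝ, E) I (extChartAt I p).symm y := by
  have h := mdifferentiableWithinAt_extChartAt_symm (I := I) hy
  rwa [I.range_eq_univ, mdifferentiableWithinAt_univ] at h

theorem mfderiv_extChartAt_prod_symm [I.Boundaryless] [J.Boundaryless] (p : M × K) {y : E × F}
    (hy₁ : y.1 ∈ (extChartAt I p.1).target) (hy₂ : y.2 ∈ (extChartAt J p.2).target)
    (u : E × F) :
    (mfderiv 𝓘(ℝ, E × F) (I.prod J) ((extChartAt I p.1).prod (extChartAt J p.2)).symm y u :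
        E × F) =
      ((mfderiv 𝓘(ℝ, E) I (extChartAt I p.1).symm y.1 u.1 : E),
        (mfderiv 𝓘(ℝ, F) J (extChartAt J p.2).symm y.2 u.2 : F)) := by
  have h1 := mdifferentiableAt_extChartAt_symm_of_mem_target p.1 hy₁
  have h2 := mdifferentiableAt_extChartAt_symm_of_mem_target p.2 hy₂
  have hf : MDifferentiableAt 𝓘(ℝ, E × F) 𝓘(ℝ, E) (Prod.fst : E × F → E) y :=
    differentiableAt_fst.mdifferentiableAt
  have hs : MDifferentiableAt 𝓘(ℝ, E × F) 𝓘(ℝ, F) (Prod.snd : E × F → F) y :=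
    differentiableAt_snd.mdifferentiableAt
  have e := mfderiv_prodMk (h1.comp y hf) (h2.comp y hs)
  have e1 := mfderiv_comp_apply y h1 hf u
  have e2 := mfderiv_comp_apply y h2 hs u
  rw [mfderiv_eq_fderiv, fderiv_fst] at e1
  rw [mfderiv_eq_fderiv, fderiv_snd] at e2
  exact (DFunLike.congr_fun e u).trans (Prod.ext e1 e2)

/-- In a product chart the product metric is the sum of the metrics of the factors. -/
theorem metricInChart_prod [I.Boundaryless] [J.Boundaryless] (g : SmoothMetric I M)
    (k : SmoothMetric J K) (p : M × K) {y : E × F}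
    (hy₁ : y.1 ∈ (extChartAt I p.1).target) (hy₂ : y.2 ∈ (extChartAt J p.2).target)
    (u v : E × F) :
    metricInChart (g.prod k) p y u v =
      metricInChart g p.1 y.1 u.1 v.1 + metricInChart k p.2 y.2 u.2 v.2 := by
  unfold metricInChart
  rw [extChartAt_prod]
  refine (prodForm_apply _ _ _ _ _).trans ?_
  have hu := mfderiv_extChartAt_prod_symm p hy₁ hy₂ u
  have hv := mfderiv_extChartAt_prod_symm p hy₁ hy₂ v
  refine congrArg₂ (· + ·) ?_ ?_
  · exact congrArg₂ (fun a b : E × F ↦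
      (g.inner ((extChartAt I p.1).symm y.1) : E →L[ℝ] E →L[ℝ] ℝ) a.1 b.1) hu hv
  · exact congrArg₂ (fun a b : E × F ↦
      (k.inner ((extChartAt J p.2).symm y.2) : F →L[ℝ] F →L[ℝ] ℝ) a.2 b.2) hu hv

theorem metricInChart_prod_self [I.Boundaryless] [J.Boundaryless] (g : SmoothMetric I M)
    (k : SmoothMetric J K) (p : M × K) (u v : E × F) :
    metricInChart (g.prod k) p (extChartAt (I.prod J) p p) u v =
      metricInChart g p.1 (extChartAt I p.1 p.1) u.1 v.1 +
        metricInChart k p.2 (extChartAt J p.2 p.2) u.2 v.2 := by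
  rw [extChartAt_prod]
  exact metricInChart_prod g k p (mem_extChartAt_target p.1) (mem_extChartAt_target p.2) u v

theorem fderiv_metricInChart_prod [I.Boundaryless] [J.Boundaryless] (g : SmoothMetric I M)
    (k : SmoothMetric J K) (p : M × K) (u v w : E × F) :
    fderiv ℝ (fun y ↦ metricInChart (g.prod k) p y u v) (extChartAt (I.prod J) p p) w =
      fderiv ℝ (fun y ↦ metricInChart g p.1 y u.1 v.1) (extChartAt I p.1 p.1) w.1 +
        fderiv ℝ (fun y ↦ metricInChart k p.2 y u.2 v.2) (extChartAt J p.2 p.2) w.2 := by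
  have e : extChartAt (I.prod J) p p = (extChartAt I p.1 p.1, extChartAt J p.2 p.2) := by
    rw [extChartAt_prod]; rfl
  rw [e]
  have h1 := HasFDerivAt.comp (f := (Prod.fst : E × F → E))
    (extChartAt I p.1 p.1, extChartAt J p.2 p.2)
    (differentiableAt_metricInChart g p.1 u.1 v.1).hasFDerivAt hasFDerivAt_fst
  have h2 := HasFDerivAt.comp (f := (Prod.snd : E × F → F))
    (extChartAt I p.1 p.1, extChartAt J p.2 p.2)
    (differentiableAt_metricInChart k p.2 u.2 v.2).hasFDerivAt hasFDerivAt_snd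
  have hev : (fun y : E × F ↦ metricInChart (g.prod k) p y u v) =ᶠ[
      nhds (extChartAt I p.1 p.1, extChartAt J p.2 p.2)]
      fun y ↦ metricInChart g p.1 y.1 u.1 v.1 + metricInChart k p.2 y.2 u.2 v.2 := by
    filter_upwards [prod_mem_nhds (extChartAt_target_mem_nhds (I := I) p.1)
      (extChartAt_target_mem_nhds (I := J) p.2)] with y hy
    exact metricInChart_prod g k p hy.1 hy.2 u v
  rw [((h1.add h2).congr_of_eventuallyEq hev).fderiv]
  rfl

theorem christoffel_prod [I.Boundaryless] [J.Boundaryless] (g : SmoothMetric I M)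
    (k : SmoothMetric J K) (p : M × K) (u v w : E × F) :
    christoffel (g.prod k) p (extChartAt (I.prod J) p p) u v w =
      christoffel g p.1 (extChartAt I p.1 p.1) u.1 v.1 w.1 +
        christoffel k p.2 (extChartAt J p.2 p.2) u.2 v.2 w.2 := by
  unfold christoffel
  rw [fderiv_metricInChart_prod, fderiv_metricInChart_prod, fderiv_metricInChart_prod]
  ring

/-- The left-hand side of the equation of parallel transport on a product is the sum of those of the
factors. -/
theorem parallel_equation_prod [I.Boundaryless] [J.Boundaryless] (g : SmoothMetric I M)
    (k : SmoothMetric J K) (p : M × K) (x' c' c w : E × F) :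
    metricInChart (g.prod k) p (extChartAt (I.prod J) p p) c' w +
        christoffel (g.prod k) p (extChartAt (I.prod J) p p) x' c w =
      metricInChart g p.1 (extChartAt I p.1 p.1) c'.1 w.1 +
        metricInChart k p.2 (extChartAt J p.2 p.2) c'.2 w.2 +
      (christoffel g p.1 (extChartAt I p.1 p.1) x'.1 c.1 w.1 +
        christoffel k p.2 (extChartAt J p.2 p.2) x'.2 c.2 w.2) := by
  rw [metricInChart_prod_self, christoffel_prod]

theorem metricInChart_zero_right (g : SmoothMetric I M) (p : M) (y u : E) :
    metricInChart g p y u 0 = 0 := by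
  rw [← chartForm_apply, map_zero]

theorem christoffel_zero_right [I.Boundaryless] (g : SmoothMetric I M) (p : M) (u v : E) :
    christoffel g p (extChartAt I p p) u v 0 = 0 := by
  unfold christoffel
  simp [metricInChart_zero_right]

/-! ### Projecting parallel vector fields to the factors -/

/-- The projection to `TM` of a curve in `T(M × K)`. -/
def fstCurve (V : ℝ → TangentBundle (I.prod J) (M × K)) (t : ℝ) : TangentBundle I M :=
  ⟨(V t).proj.1, (V t).2.1⟩

/-- The projection to `TK` of a curve in `T(M × K)`. -/
def sndCurve (V : ℝ → TangentBundle (I.prod J) (M × K)) (t : ℝ) : TangentBundle J K :=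
  ⟨(V t).proj.2, (V t).2.2⟩

theorem IsParallelAt.fstCurve [I.Boundaryless] [J.Boundaryless] {g : SmoothMetric I M}
    {k : SmoothMetric J K} {V : ℝ → TangentBundle (I.prod J) (M × K)} {t : ℝ}
    (hV : IsParallelAt (g.prod k) V t) (hc : ContinuousAt (fun s ↦ (V s).proj) t) :
    IsParallelAt g (fstCurve V) t := by
  obtain ⟨x', c', hx, hcd, heq⟩ := hV
  have hnhds : ∀ᶠ s in nhds t, (V s).proj ∈ (extChartAt (I.prod J) (V t).proj).source :=
    hc.eventually (extChartAt_source_mem_nhds (I := I.prod J) _)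
  refine ⟨x'.1, c'.1, ?_, ?_, fun w ↦ ?_⟩
  · rw [extChartAt_prod] at hx
    exact hasFDerivAt_fst.comp_hasDerivAt t hx
  · refine (hasFDerivAt_fst.comp_hasDerivAt t hcd).congr_of_eventuallyEq ?_
    filter_upwards [hnhds] with s hs
    exact (mfderiv_extChartAt_prod_fst _ hs _).symm
  · -- Testing against `(w, 0)` isolates the equation in the first factor.
    have e := (parallel_equation_prod g k (V t).proj x' c' _ (w, 0)).symm.trans (heq (w, 0))
    rw [metricInChart_zero_right, christoffel_zero_right, add_zero, add_zero,
      mfderiv_extChartAt_prod_fst _ (mem_extChartAt_source _)] at e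
    exact e

theorem IsParallelAt.sndCurve [I.Boundaryless] [J.Boundaryless] {g : SmoothMetric I M}
    {k : SmoothMetric J K} {V : ℝ → TangentBundle (I.prod J) (M × K)} {t : ℝ}
    (hV : IsParallelAt (g.prod k) V t) (hc : ContinuousAt (fun s ↦ (V s).proj) t) :
    IsParallelAt k (sndCurve V) t := by
  obtain ⟨x', c', hx, hcd, heq⟩ := hV
  have hnhds : ∀ᶠ s in nhds t, (V s).proj ∈ (extChartAt (I.prod J) (V t).proj).source :=
    hc.eventually (extChartAt_source_mem_nhds (I := I.prod J) _)
  refine ⟨x'.2, c'.2, ?_, ?_, fun w ↦ ?_⟩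
  · rw [extChartAt_prod] at hx
    exact hasFDerivAt_snd.comp_hasDerivAt t hx
  · refine (hasFDerivAt_snd.comp_hasDerivAt t hcd).congr_of_eventuallyEq ?_
    filter_upwards [hnhds] with s hs
    exact (mfderiv_extChartAt_prod_snd _ hs _).symm
  · have e := (parallel_equation_prod g k (V t).proj x' c' _ (0, w)).symm.trans (heq (0, w))
    rw [metricInChart_zero_right, christoffel_zero_right, zero_add, zero_add,
      mfderiv_extChartAt_prod_snd _ (mem_extChartAt_source _)] at e
    exact e

end ProductChart

/-! ### Block matrices -/

section Matrices

/-- The identification of index sets under which `ℝ^(2(p+q)) = ℂ^(p+q) = ℂ^p ⊕ ℂ^q` is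
`ℝ^(2q) ⊕ ℝ^(2p)`. -/
def blockEquiv (p q : ℕ) : Fin (2 * (p + q)) ≃ Fin (2 * q) ⊕ Fin (2 * p) :=
  (finSumFinEquiv.trans (finCongr (two_mul (p + q)).symm)).symm.trans <|
    (Equiv.sumCongr finSumFinEquiv.symm finSumFinEquiv.symm).trans <|
      (Equiv.sumSumSumComm _ _ _ _).trans <| (Equiv.sumComm _ _).trans <|
        Equiv.sumCongr (finSumFinEquiv.trans (finCongr (two_mul q).symm))
          (finSumFinEquiv.trans (finCongr (two_mul p).symm))

theorem realMatrix_blockDiag {p q : ℕ} (a : Matrix (Fin p) (Fin p) ℂ)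
    (b : Matrix (Fin q) (Fin q) ℂ) :
    realMatrix (blockDiag a b) =
      (Matrix.fromBlocks (realMatrix b) 0 0 (realMatrix a)).submatrix
        (blockEquiv p q) (blockEquiv p q) := by
  ext i j
  obtain ⟨i, rfl⟩ := ((Equiv.sumCongr finSumFinEquiv finSumFinEquiv).trans
    (finSumFinEquiv.trans (finCongr (two_mul (p + q)).symm))).surjective i
  obtain ⟨j, rfl⟩ := ((Equiv.sumCongr finSumFinEquiv finSumFinEquiv).trans
    (finSumFinEquiv.trans (finCongr (two_mul (p + q)).symm))).surjective j
  rcases i with (i | i) | (i | i) <;> rcases j with (j | j) | (j | j) <;>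
    simp [realMatrix, blockDiag, blockEquiv, -finSumFinEquiv_apply_left,
      -finSumFinEquiv_apply_right]

theorem blockDiag_mem_unitaryGroup {p q : ℕ} {a : Matrix (Fin p) (Fin p) ℂ}
    {b : Matrix (Fin q) (Fin q) ℂ} (ha : a ∈ Matrix.unitaryGroup (Fin p) ℂ)
    (hb : b ∈ Matrix.unitaryGroup (Fin q) ℂ) :
    blockDiag a b ∈ Matrix.unitaryGroup (Fin (p + q)) ℂ := by
  rw [Matrix.mem_unitaryGroup_iff, Matrix.star_eq_conjTranspose] at *
  simp only [blockDiag, Matrix.reindex_apply, Matrix.conjTranspose_submatrix,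
    Matrix.fromBlocks_conjTranspose]
  rw [Matrix.submatrix_mul_equiv, Matrix.fromBlocks_multiply]
  simp [ha, hb]

theorem det_blockDiag {p q : ℕ} (a : Matrix (Fin p) (Fin p) ℂ) (b : Matrix (Fin q) (Fin q) ℂ) :
    (blockDiag a b).det = a.det * b.det := by
  rw [blockDiag, Matrix.det_reindex_self, Matrix.det_fromBlocks_zero₂₁]

/-- `SU(p) × SU(q) ⊆ S(U(p) × U(q))`, as groups of real matrices. -/
theorem exists_mem_map_SUU {p q : ℕ} {A : Matrix.orthogonalGroup (Fin (2 * q)) ℝ}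
    {B : Matrix.orthogonalGroup (Fin (2 * p)) ℝ} (hA : A ∈ SU q) (hB : B ∈ SU p) :
    ∃ C ∈ (SUU p q).map (realSU (p + q)),
      (C : Matrix (Fin (2 * (p + q))) (Fin (2 * (p + q))) ℝ) =
        (Matrix.fromBlocks (A : Matrix (Fin (2 * q)) (Fin (2 * q)) ℝ) 0 0
          (B : Matrix (Fin (2 * p)) (Fin (2 * p)) ℝ)).submatrix
          (blockEquiv p q) (blockEquiv p q) := by
  obtain ⟨b, rfl⟩ := hA
  obtain ⟨a, rfl⟩ := hB
  have ha := Matrix.mem_specialUnitaryGroup_iff.1 a.2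
  have hb := Matrix.mem_specialUnitaryGroup_iff.1 b.2
  let x : Matrix.specialUnitaryGroup (Fin (p + q)) ℂ :=
    ⟨blockDiag a b, Matrix.mem_specialUnitaryGroup_iff.2
      ⟨blockDiag_mem_unitaryGroup ha.1 hb.1, by rw [det_blockDiag, ha.2, hb.2, one_mul]⟩⟩
  exact ⟨realSU (p + q) x, ⟨x, ⟨a, ha.1, b, hb.1, rfl⟩, rfl⟩, realMatrix_blockDiag _ _⟩

end Matrices

/-! ### Linear maps and bases of products -/

section LinearAlgebra

variable {A B : Type*} [AddCommGroup A] [Module ℝ A] [AddCommGroup B] [Module ℝ B]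

/-- An automorphism of `A × B` that maps `A` to `A` and `B` to `B` is a product of automorphisms. -/
theorem exists_eq_prodMap_of_linearEquiv (P : (A × B) ≃ₗ[ℝ] (A × B))
    (h₁ : ∀ b, (P (0, b)).1 = 0) (h₂ : ∀ a, (P (a, 0)).2 = 0) :
    ∃ (P₁ : A ≃ₗ[ℝ] A) (P₂ : B ≃ₗ[ℝ] B), ∀ v, P v = (P₁ v.1, P₂ v.2) := by
  let p₁ : A →ₗ[ℝ] A := LinearMap.fst ℝ A B ∘ₗ P.toLinearMap ∘ₗ LinearMap.inl ℝ A B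
  let p₂ : B →ₗ[ℝ] B := LinearMap.snd ℝ A B ∘ₗ P.toLinearMap ∘ₗ LinearMap.inr ℝ A B
  have hP : ∀ v, P v = (p₁ v.1, p₂ v.2) := by
    rintro ⟨a, b⟩
    have e : P (a, b) = P (a, 0) + P (0, b) := by rw [← map_add]; simp
    refine Prod.ext ?_ ?_
    · simp [e, h₁, p₁]
    · simp [e, h₂, p₂]
  have b₁ : Function.Bijective p₁ := by
    refine ⟨fun a a' h ↦ ?_, fun a ↦ ?_⟩
    · have : P (a, 0) = P (a', 0) := by rw [hP, hP, h]
      exact congrArg Prod.fst (P.injective this)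
    · obtain ⟨v, hv⟩ := P.surjective (a, 0)
      exact ⟨v.1, by rw [hP] at hv; exact congrArg Prod.fst hv⟩
  have b₂ : Function.Bijective p₂ := by
    refine ⟨fun b b' h ↦ ?_, fun b ↦ ?_⟩
    · have : P (0, b) = P (0, b') := by rw [hP, hP, h]
      exact congrArg Prod.snd (P.injective this)
    · obtain ⟨v, hv⟩ := P.surjective (0, b)
      exact ⟨v.2, by rw [hP] at hv; exact congrArg Prod.snd hv⟩
  exact ⟨LinearEquiv.ofBijective p₁ b₁, LinearEquiv.ofBijective p₂ b₂, hP⟩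

theorem toMatrix_prod_reindex {ι κ μ : Type*} [Fintype ι] [DecidableEq ι] [Fintype κ]
    [DecidableEq κ] [Fintype μ] [DecidableEq μ] (b : Module.Basis ι ℝ A) (b' : Module.Basis κ ℝ B)
    (e : μ ≃ ι ⊕ κ) {P : (A × B) →ₗ[ℝ] (A × B)} {P₁ : A →ₗ[ℝ] A} {P₂ : B →ₗ[ℝ] B}
    (h : ∀ v, P v = (P₁ v.1, P₂ v.2)) :
    LinearMap.toMatrix ((b.prod b').reindex e.symm) ((b.prod b').reindex e.symm) P =
      (Matrix.fromBlocks (LinearMap.toMatrix b b P₁) 0 0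
        (LinearMap.toMatrix b' b' P₂)).submatrix e e := by
  obtain rfl : P = P₁.prodMap P₂ := LinearMap.ext h
  rw [← LinearMap.toMatrix_prodMap]
  ext i j
  simp [LinearMap.toMatrix_apply]

theorem orthonormal_prod_reindex [TopologicalSpace A] [TopologicalSpace B] {ι κ μ : Type*}
    [DecidableEq ι] [DecidableEq κ] [DecidableEq μ] (b : Module.Basis ι ℝ A)
    (b' : Module.Basis κ ℝ B) (e : μ ≃ ι ⊕ κ) {α : A →L[ℝ] A →L[ℝ] ℝ} {β : B →L[ℝ] B →L[ℝ] ℝ}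
    (hb : ∀ i j, α (b i) (b j) = if i = j then 1 else 0)
    (hb' : ∀ i j, β (b' i) (b' j) = if i = j then 1 else 0) (i j : μ) :
    α ((b.prod b').reindex e.symm i).1 ((b.prod b').reindex e.symm j).1 +
        β ((b.prod b').reindex e.symm i).2 ((b.prod b').reindex e.symm j).2 =
      if i = j then 1 else 0 := by
  obtain ⟨i, rfl⟩ := e.symm.surjective i
  obtain ⟨j, rfl⟩ := e.symm.surjective j
  rcases i with i | i <;> rcases j with j | j <;> simp [hb, hb']

end LinearAlgebra

/-! ### Holonomy of a product -/

section ProductHolonomy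

variable {E : Type*} [NormedAddCommGroup E] [NormedSpace ℝ E]
  {H : Type*} [TopologicalSpace H] {I : ModelWithCorners ℝ E H}
  {M : Type*} [TopologicalSpace M] [ChartedSpace H M] [IsManifold I ∞ M]
  {F : Type*} [NormedAddCommGroup F] [NormedSpace ℝ F]
  {H' : Type*} [TopologicalSpace H'] {J : ModelWithCorners ℝ F H'}
  {K : Type*} [TopologicalSpace K] [ChartedSpace H' K] [IsManifold J ∞ K]

theorem continuousOn_fstCurve {V : ℝ → TangentBundle (I.prod J) (M × K)} {s : Set ℝ}
    (hV : ContinuousOn V s) : ContinuousOn (fstCurve V) s := by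
  have h : Continuous (tangentMap (I.prod J) I (Prod.fst : M × K → M)) :=
    (contMDiff_fst (n := ∞)).continuous_tangentMap (by simp)
  refine (h.comp_continuousOn hV).congr fun t _ ↦ ?_
  exact tangentMap_prodFst.symm

theorem continuousOn_sndCurve {V : ℝ → TangentBundle (I.prod J) (M × K)} {s : Set ℝ}
    (hV : ContinuousOn V s) : ContinuousOn (sndCurve V) s := by
  have h : Continuous (tangentMap (I.prod J) J (Prod.snd : M × K → K)) :=
    (contMDiff_snd (n := ∞)).continuous_tangentMap (by simp)
  refine (h.comp_continuousOn hV).congr fun t _ ↦ ?_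
  exact tangentMap_prodSnd.symm

theorem IsParallelAlong.fstCurve [I.Boundaryless] [J.Boundaryless] {g : SmoothMetric I M}
    {k : SmoothMetric J K} {N : ℕ} {τ : Fin (N + 1) → ℝ} {γ : ℝ → M × K}
    {V : ℝ → TangentBundle (I.prod J) (M × K)}
    (hV : IsParallelAlong (g.prod k) τ γ V) (hτ : IsSubdivision τ) :
    IsParallelAlong g τ (fun t ↦ (γ t).1) (fstCurve V) :=
  ⟨fun t ht ↦ congrArg Prod.fst (hV.1 t ht), continuousOn_fstCurve hV.2.1,
    fun i t ht ↦ (hV.2.2 i t ht).fstCurve (hV.continuousAt_proj hτ ht)⟩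

theorem IsParallelAlong.sndCurve [I.Boundaryless] [J.Boundaryless] {g : SmoothMetric I M}
    {k : SmoothMetric J K} {N : ℕ} {τ : Fin (N + 1) → ℝ} {γ : ℝ → M × K}
    {V : ℝ → TangentBundle (I.prod J) (M × K)}
    (hV : IsParallelAlong (g.prod k) τ γ V) (hτ : IsSubdivision τ) :
    IsParallelAlong k τ (fun t ↦ (γ t).2) (sndCurve V) :=
  ⟨fun t ht ↦ congrArg Prod.snd (hV.1 t ht), continuousOn_sndCurve hV.2.1,
    fun i t ht ↦ (hV.2.2 i t ht).sndCurve (hV.continuousAt_proj hτ ht)⟩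

theorem IsPiecewiseSmooth.fst {N : ℕ} {τ : Fin (N + 1) → ℝ} {γ : ℝ → M × K}
    (hγ : IsPiecewiseSmooth (I.prod J) τ γ) : IsPiecewiseSmooth I τ (fun t ↦ (γ t).1) :=
  ⟨hγ.1, fun i ↦ contMDiff_fst.comp_contMDiffOn (hγ.2 i)⟩

theorem IsPiecewiseSmooth.snd {N : ℕ} {τ : Fin (N + 1) → ℝ} {γ : ℝ → M × K}
    (hγ : IsPiecewiseSmooth (I.prod J) τ γ) : IsPiecewiseSmooth J τ (fun t ↦ (γ t).2) :=
  ⟨hγ.1, fun i ↦ contMDiff_snd.comp_contMDiffOn (hγ.2 i)⟩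

/-- The holonomy group of a product at `p` is contained in the product of the holonomy groups of
the factors. -/
theorem exists_mem_holonomyGroup_of_mem_prod [I.Boundaryless] [J.Boundaryless]
    (g : SmoothMetric I M) (k : SmoothMetric J K) (p : M × K)
    {P : TangentSpace (I.prod J) p ≃ₗ[ℝ] TangentSpace (I.prod J) p}
    (hP : P ∈ holonomyGroup (g.prod k) p) :
    ∃ P₁ ∈ holonomyGroup g p.1, ∃ P₂ ∈ holonomyGroup k p.2,
      ∀ v : TangentSpace (I.prod J) p, P v = (P₁ v.1, P₂ v.2) := by
  obtain ⟨N, τ, γ, hγ, h0, h1, hV⟩ := hP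
  -- Transporting a vector tangent to one factor, the component along the other stays zero.
  have hz₁ : ∀ b : F, (P ((0, b) : E × F)).1 = 0 := by
    intro b
    obtain ⟨V, hpar, e0, e1⟩ := hV ((0, b) : E × F)
    have f0 : fstCurve V 0 = ⟨p.1, (0 : E)⟩ := by unfold fstCurve; rw [e0]
    have f1 : fstCurve V 1 = ⟨p.1, (P ((0, b) : E × F)).1⟩ := by unfold fstCurve; rw [e1]
    have h := (hpar.fstCurve hγ.1).eq_zero hγ.1 (by rw [f0]; rfl)
    rw [f1] at h
    exact h
  have hz₂ : ∀ a : E, (P ((a, 0) : E × F)).2 = 0 := by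
    intro a
    obtain ⟨V, hpar, e0, e1⟩ := hV ((a, 0) : E × F)
    have f0 : sndCurve V 0 = ⟨p.2, (0 : F)⟩ := by unfold sndCurve; rw [e0]
    have f1 : sndCurve V 1 = ⟨p.2, (P ((a, 0) : E × F)).2⟩ := by unfold sndCurve; rw [e1]
    have h := (hpar.sndCurve hγ.1).eq_zero hγ.1 (by rw [f0]; rfl)
    rw [f1] at h
    exact h
  obtain ⟨P₁, P₂, h⟩ := exists_eq_prodMap_of_linearEquiv
    (A := TangentSpace I p.1) (B := TangentSpace J p.2) P hz₁ hz₂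
  refine ⟨P₁, ⟨N, τ, _, hγ.fst, congrArg Prod.fst h0, congrArg Prod.fst h1, fun v ↦ ?_⟩,
    P₂, ⟨N, τ, _, hγ.snd, congrArg Prod.snd h0, congrArg Prod.snd h1, fun v ↦ ?_⟩, h⟩
  · obtain ⟨V, hpar, e0, e1⟩ := hV ((v, 0) : E × F)
    refine ⟨fstCurve V, hpar.fstCurve hγ.1, by unfold fstCurve; rw [e0], ?_⟩
    unfold fstCurve
    rw [e1]
    exact congrArg (fun w : E × F ↦ (⟨p.1, w.1⟩ : TangentBundle I M)) (h (v, 0))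
  · obtain ⟨V, hpar, e0, e1⟩ := hV ((0, v) : E × F)
    refine ⟨sndCurve V, hpar.sndCurve hγ.1, by unfold sndCurve; rw [e0], ?_⟩
    unfold sndCurve
    rw [e1]
    exact congrArg (fun w : E × F ↦ (⟨p.2, w.2⟩ : TangentBundle J K)) (h (0, v))

/-- The product of an `SU(q)`-manifold and an `SU(p)`-manifold is an `S(U(p) × U(q))`-manifold. -/
theorem IsCalabiYau.prod [I.Boundaryless] [J.Boundaryless] {p q : ℕ} (hq : q ≠ 0) (hp : p ≠ 0)
    {g : SmoothMetric I M} {k : SmoothMetric J K} (hM : IsCalabiYau q g) (hK : IsCalabiYau p k) :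
    IsGManifold ((SUU p q).map (realSU (p + q))) (g.prod k) := by
  obtain ⟨hE, hM⟩ := hM
  obtain ⟨hF, hK⟩ := hK
  -- `finrank` is zero in infinite dimension, so the positive dimensions give finiteness.
  have : Module.Finite ℝ E := Module.finite_of_finrank_pos (by omega)
  have : Module.Finite ℝ F := Module.finite_of_finrank_pos (by omega)
  refine ⟨by rw [Module.finrank_prod]; omega, fun x ↦ ?_⟩
  obtain ⟨b, hb, hbP⟩ := hM x.1
  obtain ⟨b', hb', hbP'⟩ := hK x.2
  refine ⟨(b.prod b').reindex (blockEquiv p q).symm, fun i j ↦ ?_, fun P hP ↦ ?_⟩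
  · refine (prodForm_apply x _ _ _ _).trans ?_
    exact orthonormal_prod_reindex b b' (blockEquiv p q) hb hb' i j
  · obtain ⟨P₁, hP₁, P₂, hP₂, h⟩ := exists_mem_holonomyGroup_of_mem_prod g k x hP
    obtain ⟨A, hA, hA'⟩ := hbP P₁ hP₁
    obtain ⟨B, hB, hB'⟩ := hbP' P₂ hP₂
    obtain ⟨C, hC, hC'⟩ := exists_mem_map_SUU hA hB
    refine ⟨C, hC, ?_⟩
    rw [hC', ← hA', ← hB']
    exact toMatrix_prod_reindex b b' (blockEquiv p q) h

end ProductHolonomy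

end HolonomyReduction

theorem mainTheorem2
    {E : Type*} [NormedAddCommGroup E] [NormedSpace ℝ E]
    {H : Type*} [TopologicalSpace H] (I : ModelWithCorners ℝ E H) [I.Boundaryless]
    {M : Type*} [TopologicalSpace M] [ChartedSpace H M] [IsManifold I ∞ M]
    {F : Type*} [NormedAddCommGroup F] [NormedSpace ℝ F]
    {H' : Type*} [TopologicalSpace H'] (J : ModelWithCorners ℝ F H') [J.Boundaryless]
    {K : Type*} [TopologicalSpace K] [ChartedSpace H' K] [IsManifold J ∞ K]
    (g : HolonomyReduction.SmoothMetric I M)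
    (k : HolonomyReduction.SmoothMetric J K)
    (hM : HolonomyReduction.IsCalabiYau 2 g)
    (hK : HolonomyReduction.IsCalabiYau 3 k) :
    HolonomyReduction.IsGManifold HolonomyReduction.gaugeGroup (g.prod k) :=
  HolonomyReduction.IsCalabiYau.prod two_ne_zero three_ne_zero hM hK
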